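/- **Setting.** All matrices are complex. For a Hermitian matrix $A=\sum_i\alpha_i|i\rangle\langle i|$ and a real function $f$ defined on the spectrum of $A$, $f(A)=\sum_i f(\alpha_i)|i\rangle\langle i|$; for $A$ strictly positive and $z\in\mathbb C$, $A^z=\sum_i\alpha_i^z|i\rangle\langle i|$. A real function $f$ on an interval $I\subseteq\mathbb R$ is *operator convex* if $f(sA+(1-s)B)\le s f(A)+(1-s)f(B)$ (Loewner order) for all $0\le s\le 1$ and all Hermitian $A,B$ of any common size with spectra in $I$. It is *affine* if $f(t)=b+ct$ on $I$ for some real $b,c$. It is *diffused* if $I=(t_0-a,t_0+a)$ for some $t_0\in\mathbb R$, $a>0$, and $$f(t)=b+ct+d\int_{[-a,a]}\frac{(t-t_0)^2}{a^2-(t-t_0)x}\,d\mu(x),\qquad t\in I,$$ with $b,c\in\mathbb R$, $d>0$ and a probability measure $\mu$ on $[-a,a]$ whose density (the Radon–Nikodym derivative, with respect to Lebesgue measure, of its absolutely continuous part) is strictly positive almost everywhere on some non-degenerate subinterval of $[-a,a]$ that has $0$ as an interior or boundary point. For strictly positive $\rho,\sigma$ of the same size such that the spectrum of $\sigma\otimes(\rho^{-1})^{\mathsf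 T}$ lies in $I$, the quantum $f$-relative entropy is $$S_f(\rho\|\sigma)=\mathrm{vec}(\sqrt\rho)^\dagger\, f\!\left[\sigma\otimes(\rho^{-1})^{\mathsf T}\right]\mathrm{vec}(\sqrt\rho),$$ where $\mathrm{vec}$ stacks the rows of a matrix into a column vector. **Lemma (joint convexity).** Let $f$ be operator convex on an interval $I$, let $0<\lambda<1$, and let $\rho_1,\rho_2,\sigma_1,\sigma_2$ be strictly positive matrices of the same size (not necessarily of unit trace) such that the spectra of $\sigma_i\otimes(\rho_i^{-1})^{\mathsf T}$, $i=1,2$, lie in $I$. Put $\rho_\lambda=\lambda\rho_1+(1-\lambda)\rho_2$ and $\sigma_\lambda=\lambda\sigma_1+(1-\lambda)\sigma_2$. Then $$S_f(\rho_\lambda\|\sigma_\lambda)\le\lambda S_f(\rho_1\|\sigma_1)+(1-\lambda)S_f(\rho_2\|\sigma_2).$$ If moreover $f$ is non-affine and diffused, then equality holds if and only if $$\mathrm{Tr}\left(\sigma_\lambda^{\imath t}\rho_\lambda^{1-\imath t}\right)=\lambda\,\mathrm{Tr}\left(\sigma_1^{\imath t}\rho_1^{1-\imath t}\right)+(1-\lambda)\,\mathrm{Tr}\left(\sigma_2^{\imath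 t}\rho_2^{1-\imath t}\right)\qquad\text{for all } t\in\mathbb C,\ \imath=\sqrt{-1}.$$ -/

import Mathlib

open Matrix MeasureTheory
open scoped Kronecker ComplexOrder

noncomputable section

namespace QuantumFRel

variable {n : Type*} [Fintype n] [DecidableEq n]

/-- `f` is operator convex on the interval `I`: for Hermitian complex matrices `A`, `B` of any
common size, with spectra in `I`, one has `f (s A + (1 - s) B) ≤ s f (A) + (1 - s) f (B)` in the
Loewner order. Here `f (A)` is the functional calculus `∑ f (αᵢ) |i⟩⟨i|`. -/
def OperatorConvexOn (I : Set ℝ) (f : ℝ → ℝ) : Prop :=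
  ∀ (m : ℕ) (A B : Matrix (Fin m) (Fin m) ℂ), A.IsHermitian → B.IsHermitian →
    spectrum ℝ A ⊆ I → spectrum ℝ B ⊆ I → ∀ s : ℝ, 0 ≤ s → s ≤ 1 →
      (s • cfc f A + (1 - s) • cfc f B - cfc f (s • A + (1 - s) • B)).PosSemidef

/-- `f` coincides with an affine function on `I`. -/
def AffineOn (I : Set ℝ) (f : ℝ → ℝ) : Prop :=
  ∃ b c : ℝ, ∀ t ∈ I, f t = b + c * t

/-- `f` is diffused on `I = (t₀ - a, t₀ + a)`: in its integral representation
`f t = b + c t + d ∫ (t - t₀)² / (a² - (t - t₀) x) dμ(x)`, with `d > 0` and `μ` a probability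
distribution on `[-a, a]`, the (Lebesgue) density of `μ` is strictly positive almost everywhere on
a non-degenerate subinterval `[u, v]` of `[-a, a]` that contains `0`
(as an interior or a boundary point). -/
def DiffusedOn (I : Set ℝ) (f : ℝ → ℝ) : Prop :=
  ∃ (t₀ a b c d : ℝ) (μ : Measure ℝ),
    0 < a ∧ I = Set.Ioo (t₀ - a) (t₀ + a) ∧ 0 < d ∧
    IsProbabilityMeasure μ ∧ μ (Set.Icc (-a) a)ᶜ = 0 ∧
    (∀ t ∈ I, f t = b + c * t + d * ∫ x, (t - t₀) ^ 2 / (a ^ 2 - (t - t₀) * x) ∂μ) ∧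
    ∃ u v : ℝ, -a ≤ u ∧ u ≤ 0 ∧ 0 ≤ v ∧ v ≤ a ∧ u < v ∧
      ∀ᵐ x ∂(volume.restrict (Set.Icc u v)), 0 < μ.rnDeriv volume x

/-- The row-stacking vectorization of a matrix. -/
def rowVec (A : Matrix n n ℂ) : n × n → ℂ := fun ij => A ij.1 ij.2

/-- The matrix `σ ⊗ (ρ⁻¹)ᵀ`. -/
def relMod (ρ σ : Matrix n n ℂ) : Matrix (n × n) (n × n) ℂ := σ ⊗ₖ (ρ⁻¹)ᵀ

/-- The quantum `f`-relative entropy `S_f(ρ‖σ) = vec(√ρ)† f(σ ⊗ (ρ⁻¹)ᵀ) vec(√ρ)` (a real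
number, since `f` is real valued). -/
def fRelEntropy (f : ℝ → ℝ) (ρ σ : Matrix n n ℂ) : ℝ :=
  (star (rowVec (cfc Real.sqrt ρ)) ⬝ᵥ
    (cfc f (relMod ρ σ) *ᵥ rowVec (cfc Real.sqrt ρ))).re

/-- The complex power `A ^ z = ∑ αᵢ ^ z |i⟩⟨i|` of a positive definite matrix: the functional
calculus of the complex-valued function `x ↦ x ^ z`, taken on real and imaginary parts. -/
def mpow (A : Matrix n n ℂ) (z : ℂ) : Matrix n n ℂ :=
  cfc (fun x : ℝ => ((x : ℂ) ^ z).re) A + Complex.I • cfc (fun x : ℝ => ((x : ℂ) ^ z).im) A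

/-- The power in terms of a spectral decomposition. -/
theorem mpow_eq {A : Matrix n n ℂ} (hA : A.IsHermitian) (z : ℂ) :
    mpow A z = (hA.eigenvectorUnitary : Matrix n n ℂ) *
      diagonal (fun i => (hA.eigenvalues i : ℂ) ^ z) *
      star (hA.eigenvectorUnitary : Matrix n n ℂ) := by
  have key : (diagonal (fun i => (hA.eigenvalues i : ℂ) ^ z) : Matrix n n ℂ) =
      diagonal (fun i => ((((hA.eigenvalues i : ℂ) ^ z).re : ℝ) : ℂ)) +
      Complex.I • diagonal (fun i => ((((hA.eigenvalues i : ℂ) ^ z).im : ℝ) : ℂ)) := by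
    rw [← diagonal_smul, diagonal_add]
    congr 1
    funext i
    simp only [Pi.smul_apply, smul_eq_mul]
    rw [mul_comm, Complex.re_add_im]
  rw [mpow, hA.cfc_eq, hA.cfc_eq, key, Matrix.mul_add, Matrix.add_mul]
  simp [IsHermitian.cfc, Unitary.conjStarAlgAut_apply, Function.comp_def]

end QuantumFRel

end

/-! Convexity: with T = √ρ_λ, stack √λ (1 ⊗ (T⁻¹√ρ₁)ᵀ) on √(1-λ) (1 ⊗ (T⁻¹√ρ₂)ᵀ). The result is an
isometry V that compresses the direct sum of the two operators σᵢ ⊗ (ρᵢ⁻¹)ᵀ to the one of the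
averaged pair, and it sends vec(T) to √λ vec(√ρ₁) ⊕ √(1-λ) vec(√ρ₂) (`exists_isometry_relMod`). The
operator Jensen inequality (`posSemidef_compression_sub`), evaluated at vec(T), is the claim.

Equality: the convexity defects of S_g for all g, and the defects of the traces at all exponents z,
are the integrals of g and of s ↦ s^z against one finitely supported signed measure
(`exists_defect_weights`). Both sides of the equivalence say that this measure is zero. If the trace
identities hold, all its moments vanish. If the defect of f vanishes, then, since the measure kills
affine functions, the μ-integral of the defects of the kernels is zero; these are nonnegative
because each kernel is operator convex, so they vanish for infinitely many x. As a function of x the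
kernel defect is rational, with one pole for each atom other than t₀, so every atom must vanish
(`fiber_sum_eq_zero_of_kernelFun`). -/

noncomputable section

namespace QuantumFRel

variable {n : Type*} [Fintype n] [DecidableEq n]

/-! ### Functional calculus of Hermitian matrices -/

section FunctionalCalculus

variable {m : Type*} [Fintype m] [DecidableEq m]

/-- Spectra of matrices are finite, so `cfc g` is always a polynomial in the matrix, with no
continuity asked of `g`; identities for `cfc` reduce to identities for `Polynomial.aeval`. -/
theorem exists_polynomial_eq_on (g : ℝ → ℝ) {S : Set ℝ} (hS : S.Finite) :
    ∃ p : Polynomial ℝ, ∀ x ∈ S, p.eval x = g x :=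
  ⟨Lagrange.interpolate hS.toFinset id g, fun x hx => by
    simpa using Lagrange.eval_interpolate_at_node (s := hS.toFinset) (v := id) g
      Function.injective_id.injOn (hS.mem_toFinset.2 hx)⟩

theorem cfc_eq_aeval {A : Matrix n n ℂ} (hA : A.IsHermitian) (g : ℝ → ℝ) {p : Polynomial ℝ}
    (hp : ∀ x ∈ spectrum ℝ A, p.eval x = g x) : cfc g A = Polynomial.aeval A p := by
  rw [← cfc_polynomial p A hA.isSelfAdjoint]
  exact cfc_congr fun x hx => (hp x hx).symm

theorem cfc_affine {A : Matrix n n ℂ} (hA : A.IsHermitian) (b c : ℝ) :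
    cfc (fun t => b + c * t) A = b • (1 : Matrix n n ℂ) + c • A := by
  rw [cfc_eq_aeval hA _ (p := Polynomial.C b + Polynomial.C c * Polynomial.X) (by simp)]
  simp [Algebra.algebraMap_eq_smul_one]

theorem map_cfc (φ : Matrix n n ℂ →ₐ[ℝ] Matrix m m ℂ) {A : Matrix n n ℂ} (hA : A.IsHermitian)
    (hφ : (φ A).IsHermitian) (g : ℝ → ℝ) : φ (cfc g A) = cfc g (φ A) := by
  obtain ⟨p, hp⟩ := exists_polynomial_eq_on g A.finite_real_spectrum
  rw [cfc_eq_aeval hA g hp, cfc_eq_aeval hφ g fun x hx => hp x (AlgHom.spectrum_apply_subset φ A hx),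
    Polynomial.aeval_algHom_apply]

theorem isHermitian_diagonal_ofReal {ι : Type*} [DecidableEq ι] (d : ι → ℝ) :
    (diagonal fun i => (d i : ℂ)).IsHermitian := by
  simp [IsHermitian, diagonal_conjTranspose, Pi.star_def]

theorem spectrum_diagonal_ofReal (d : n → ℝ) :
    spectrum ℝ (diagonal fun i => (d i : ℂ)) = Set.range d := by
  ext x
  rw [← spectrum.algebraMap_mem_iff ℂ, spectrum_diagonal]
  simp

theorem aeval_diagonal_ofReal (d : n → ℝ) (p : Polynomial ℝ) :
    Polynomial.aeval (diagonal fun i => (d i : ℂ)) p = diagonal fun i => ((p.eval (d i) : ℝ) : ℂ) := by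
  have h := Polynomial.aeval_algHom_apply (diagonalAlgHom ℝ (n := n) (α := ℂ))
    (fun i => (d i : ℂ)) p
  simp only [diagonalAlgHom_apply] at h
  rw [h]
  congr 1
  funext i
  have h2 := Polynomial.aeval_algHom_apply (Pi.evalAlgHom ℝ (fun _ : n => ℂ) i)
    (fun i => (d i : ℂ)) p
  rw [Pi.evalAlgHom_apply, Pi.evalAlgHom_apply] at h2
  rw [← h2]
  exact (Polynomial.aeval_algebraMap_apply ℂ (d i) p).trans (by simp)

theorem cfc_diagonal_ofReal (d : n → ℝ) (g : ℝ → ℝ) :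
    cfc g (diagonal fun i => (d i : ℂ)) = diagonal fun i => ((g (d i) : ℝ) : ℂ) := by
  obtain ⟨p, hp⟩ := exists_polynomial_eq_on g (Set.finite_range d)
  rw [cfc_eq_aeval (isHermitian_diagonal_ofReal d) g fun x hx =>
    hp x (spectrum_diagonal_ofReal d ▸ hx), aeval_diagonal_ofReal]
  congr 1
  funext i
  rw [hp _ ⟨i, rfl⟩]

theorem cfc_unitary_conj {A U : Matrix n n ℂ} (hA : A.IsHermitian) (hU : U * Uᴴ = 1)
    (g : ℝ → ℝ) : cfc g (U * A * Uᴴ) = U * cfc g A * Uᴴ := by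
  let V : unitary (Matrix n n ℂ) := ⟨U, by
    rw [Unitary.mem_iff]; exact ⟨mul_eq_one_comm.1 hU, hU⟩⟩
  have h := map_cfc (Unitary.conjStarAlgAut ℝ (Matrix n n ℂ) V).toAlgEquiv.toAlgHom hA
    (by
      have : (U * A * Uᴴ).IsHermitian := isHermitian_mul_mul_conjTranspose U hA
      simpa [Unitary.conjStarAlgAut_apply, V, star_eq_conjTranspose] using this) g
  simpa [Unitary.conjStarAlgAut_apply, V, star_eq_conjTranspose] using h.symm

theorem spectrum_unitary_conj {A U : Matrix n n ℂ} (hU : U * Uᴴ = 1) :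
    spectrum ℝ (U * A * Uᴴ) = spectrum ℝ A :=
  Unitary.spectrum_star_right_conjugate (U := (⟨U, by
    rw [Unitary.mem_iff]; exact ⟨mul_eq_one_comm.1 hU, hU⟩⟩ : unitary (Matrix n n ℂ)))

theorem aeval_fromBlocks_diag (A : Matrix n n ℂ) (B : Matrix m m ℂ) (p : Polynomial ℝ) :
    Polynomial.aeval (fromBlocks A 0 0 B) p =
      fromBlocks (Polynomial.aeval A p) 0 0 (Polynomial.aeval B p) := by
  induction p using Polynomial.induction_on' with
  | add p q hp hq => simp [hp, hq, fromBlocks_add]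
  | monomial k a =>
    have hk : (fromBlocks A 0 0 B) ^ k = fromBlocks (A ^ k) 0 0 (B ^ k) := by
      induction k with
      | zero => simp [fromBlocks_one]
      | succ k ih => simp [pow_succ, ih, fromBlocks_multiply]
    simp [Polynomial.aeval_monomial, hk, Algebra.algebraMap_eq_smul_one, fromBlocks_smul]

theorem spectrum_fromBlocks_diag (A : Matrix n n ℂ) (B : Matrix m m ℂ) :
    spectrum ℝ (fromBlocks A 0 0 B) = spectrum ℝ A ∪ spectrum ℝ B := by
  ext x
  have h : algebraMap ℝ (Matrix (n ⊕ m) (n ⊕ m) ℂ) x - fromBlocks A 0 0 B =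
      fromBlocks (algebraMap ℝ _ x - A) 0 0 (algebraMap ℝ _ x - B) := by
    simp [Algebra.algebraMap_eq_smul_one, ← fromBlocks_one, fromBlocks_smul, sub_eq_add_neg,
      fromBlocks_neg, fromBlocks_add]
  simp only [spectrum.mem_iff, Set.mem_union, h, isUnit_iff_isUnit_det, det_fromBlocks_zero₂₁,
    IsUnit.mul_iff]
  tauto

theorem cfc_fromBlocks_diag {A : Matrix n n ℂ} {B : Matrix m m ℂ} (hA : A.IsHermitian)
    (hB : B.IsHermitian) (g : ℝ → ℝ) :
    cfc g (fromBlocks A 0 0 B) = fromBlocks (cfc g A) 0 0 (cfc g B) := by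
  obtain ⟨p, hp⟩ := exists_polynomial_eq_on g (A.finite_real_spectrum.union B.finite_real_spectrum)
  rw [cfc_eq_aeval hA g fun x hx => hp x (.inl hx), cfc_eq_aeval hB g fun x hx => hp x (.inr hx),
    cfc_eq_aeval (IsHermitian.fromBlocks hA (by simp) hB) g fun x hx =>
      hp x (spectrum_fromBlocks_diag A B ▸ hx), aeval_fromBlocks_diag]

/-- Transfers the definition from `Fin m` to an arbitrary finite index type by reindexing. -/
theorem OperatorConvexOn.posSemidef {I : Set ℝ} {f : ℝ → ℝ} (hf : OperatorConvexOn I f)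
    {A B : Matrix n n ℂ} (hA : A.IsHermitian) (hB : B.IsHermitian) (hAI : spectrum ℝ A ⊆ I)
    (hBI : spectrum ℝ B ⊆ I) {s : ℝ} (hs : 0 ≤ s) (hs' : s ≤ 1) :
    (s • cfc f A + (1 - s) • cfc f B - cfc f (s • A + (1 - s) • B)).PosSemidef := by
  let e := Fintype.equivFin n
  let φ : Matrix n n ℂ ≃ₐ[ℝ] Matrix (Fin (Fintype.card n)) (Fin (Fintype.card n)) ℂ :=
    reindexAlgEquiv ℝ ℂ e
  have hφ : ∀ M : Matrix n n ℂ, φ M = M.submatrix e.symm e.symm := fun M => by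
    simp [φ, reindex_apply]
  have hH : ∀ M : Matrix n n ℂ, M.IsHermitian → (φ M).IsHermitian := fun M hM => by
    rw [hφ]; exact hM.submatrix _
  have hc : ∀ M : Matrix n n ℂ, M.IsHermitian → cfc f (φ M) = φ (cfc f M) := fun M hM =>
    (map_cfc φ.toAlgHom hM (hH M hM) f).symm
  have h := hf _ (φ A) (φ B) (hH A hA) (hH B hB)
    ((AlgHom.spectrum_apply_subset φ A).trans hAI) ((AlgHom.spectrum_apply_subset φ B).trans hBI)
    s hs hs'
  have hAB : (s • A + (1 - s) • B).IsHermitian :=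
    ((IsSelfAdjoint.all s).smul hA.isSelfAdjoint).add
      ((IsSelfAdjoint.all (1 - s)).smul hB.isSelfAdjoint)
  rw [← map_smul, ← map_smul, ← map_add, hc A hA, hc B hB, hc _ hAB, ← map_smul, ← map_smul,
    ← map_add, ← map_sub, hφ] at h
  exact (posSemidef_submatrix_equiv e.symm).1 h

end FunctionalCalculus

/-! ### The operator Jensen inequality -/

section Jensen

variable {m : Type*} [Fintype m] [DecidableEq m]

/-- The columns of an isometry are orthonormal, so they extend to an orthonormal basis, whose
vectors are the columns of `U`. -/
theorem exists_unitary_extending_isometry {V : Matrix (n ⊕ m) n ℂ} (hV : Vᴴ * V = 1) :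
    ∃ U : Matrix (n ⊕ m) (n ⊕ m) ℂ, U * Uᴴ = 1 ∧ U.toCols₁ = V := by
  let v : n ⊕ m → EuclideanSpace ℂ (n ⊕ m) :=
    Sum.elim (fun j => WithLp.toLp 2 fun i => V i j) 0
  have hv : Orthonormal ℂ ((Set.range Sum.inl).domRestrict v) := by
    rw [orthonormal_iff_ite]
    rintro ⟨_, i, rfl⟩ ⟨_, j, rfl⟩
    have h := congrFun (congrFun hV i) j
    rw [mul_apply] at h
    refine Eq.trans (Finset.sum_congr rfl fun k _ => mul_comm _ _) (h.trans ?_)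
    rw [one_apply]
    by_cases hij : i = j
    · subst hij; simp
    · rw [if_neg hij, if_neg]
      exact fun h' => hij (Sum.inl_injective (congrArg Subtype.val h'))
  obtain ⟨b, hb⟩ := hv.exists_orthonormalBasis_extension_of_card_eq (by simp)
  refine ⟨of fun i j => b j i, mul_eq_one_comm.1 ?_, ?_⟩
  · ext i j
    have h := orthonormal_iff_ite.1 b.orthonormal i j
    simp only [PiLp.inner_apply, RCLike.inner_apply] at h
    rw [mul_apply, one_apply, ← h]
    exact Finset.sum_congr rfl fun k _ => mul_comm _ _
  · ext i j
    simp [toCols₁, hb _ ⟨j, rfl⟩, v]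

/-- Operator Jensen inequality. Extending `V` to a unitary `U` makes the compression the upper left
block of `Uᴴ * A * U`. Deleting off-diagonal blocks is averaging with a unitary conjugate, so
midpoint convexity gives the inequality for block diagonals, and its upper left block is the claim.
-/
theorem posSemidef_compression_sub {I : Set ℝ} {f : ℝ → ℝ} (hf : OperatorConvexOn I f)
    {A : Matrix (n ⊕ m) (n ⊕ m) ℂ} (hA : A.IsHermitian) (hAI : spectrum ℝ A ⊆ I)
    {V : Matrix (n ⊕ m) n ℂ} (hV : Vᴴ * V = 1) :
    (Vᴴ * cfc f A * V - cfc f (Vᴴ * A * V)).PosSemidef := by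
  obtain ⟨U, hU, rfl⟩ := exists_unitary_extending_isometry hV
  have hU' : Uᴴ * Uᴴᴴ = 1 := by rw [conjTranspose_conjTranspose]; exact mul_eq_one_comm.1 hU
  have hcomp : ∀ M : Matrix (n ⊕ m) (n ⊕ m) ℂ,
      U.toCols₁ᴴ * M * U.toCols₁ = (Uᴴ * M * U).toBlocks₁₁ := fun M => by
    ext i j
    simp [mul_apply, toCols₁, toBlocks₁₁]
  have hBc : cfc f (Uᴴ * A * U) = Uᴴ * cfc f A * U := by
    simpa using cfc_unitary_conj hA hU' f
  have hBs : spectrum ℝ (Uᴴ * A * U) = spectrum ℝ A := by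
    simpa using spectrum_unitary_conj (A := A) hU'
  have hB : (Uᴴ * A * U).IsHermitian := isHermitian_conjTranspose_mul_mul U hA
  rw [hcomp, hcomp, ← hBc]
  generalize Uᴴ * A * U = B at hB hBs
  -- Conjugation by `Z` flips the sign of the off-diagonal blocks, so they cancel in the average.
  let Z : Matrix (n ⊕ m) (n ⊕ m) ℂ := fromBlocks 1 0 0 (-1)
  have hZH : Zᴴ = Z := by simp [Z, fromBlocks_conjTranspose]
  have hZ : Z * Zᴴ = 1 := by rw [hZH]; simp [Z, fromBlocks_multiply, fromBlocks_one]
  have hpinch : ∀ M : Matrix (n ⊕ m) (n ⊕ m) ℂ, (1 / 2 : ℝ) • M + (1 - 1 / 2 : ℝ) • (Z * M * Zᴴ) =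
      fromBlocks M.toBlocks₁₁ 0 0 M.toBlocks₂₂ := fun M => by
    have h2 : (1 - 1 / 2 : ℝ) = 1 / 2 := by norm_num
    conv_lhs => rw [← fromBlocks_toBlocks M]
    rw [h2, hZH]
    simp only [Z, fromBlocks_multiply, fromBlocks_smul, fromBlocks_add]
    simp [← add_smul, -one_div, add_halves]
  have h := hf.posSemidef hB (isHermitian_mul_mul_conjTranspose Z hB) (hBs.trans_subset hAI)
    ((spectrum_unitary_conj hZ).trans_subset (hBs.trans_subset hAI))
    (s := 1 / 2) (by norm_num) (by norm_num)
  rw [cfc_unitary_conj hB hZ, hpinch, hpinch,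
    cfc_fromBlocks_diag (A := B.toBlocks₁₁) (B := B.toBlocks₂₂) (hB.submatrix Sum.inl)
      (hB.submatrix Sum.inr)] at h
  have h' := h.submatrix (Sum.inl : n → n ⊕ m)
  convert h' using 1
  ext i j
  rfl

/-- Turns spectral bounds into positive definiteness, which survives convex combinations and
compressions by injective maps. -/
theorem spectrum_subset_Ioo_iff {A : Matrix n n ℂ} (hA : A.IsHermitian) {u v : ℝ} :
    spectrum ℝ A ⊆ Set.Ioo u v ↔
      (A - u • (1 : Matrix n n ℂ)).PosDef ∧ (v • (1 : Matrix n n ℂ) - A).PosDef := by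
  have h1 : ∀ c : ℝ, (c • (1 : Matrix n n ℂ)).IsHermitian := fun c =>
    (IsSelfAdjoint.all c).smul isHermitian_one.isSelfAdjoint
  have hu : (A - u • (1 : Matrix n n ℂ)) = cfc (fun x => x - u) A := by
    simpa [sub_eq_neg_add] using (cfc_affine hA (-u) 1).symm
  have hv : (v • (1 : Matrix n n ℂ) - A) = cfc (fun x => v - x) A := by
    simpa [sub_eq_add_neg] using (cfc_affine hA v (-1)).symm
  have key : ∀ B : Matrix n n ℂ, B.IsHermitian → (B.PosDef ↔ ∀ x ∈ spectrum ℝ B, 0 < x) := by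
    intro B hB
    rw [hB.posDef_iff_eigenvalues_pos, hB.spectrum_real_eq_range_eigenvalues]
    simp
  rw [key _ (hA.sub (h1 u)), key _ ((h1 v).sub hA), hu, hv,
    cfc_map_spectrum (R := ℝ) _ A hA.isSelfAdjoint (by fun_prop),
    cfc_map_spectrum (R := ℝ) _ A hA.isSelfAdjoint (by fun_prop)]
  simp [Set.subset_def, forall_and]

theorem spectrum_compression_subset {A : Matrix m m ℂ} (hA : A.IsHermitian) {u v : ℝ}
    (hAI : spectrum ℝ A ⊆ Set.Ioo u v) {V : Matrix m n ℂ} (hV : Vᴴ * V = 1) :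
    spectrum ℝ (Vᴴ * A * V) ⊆ Set.Ioo u v := by
  have hinj : Function.Injective V.mulVec := fun x y hxy => by
    have h := congrArg (Vᴴ *ᵥ ·) hxy
    simpa [mulVec_mulVec, hV] using h
  rw [spectrum_subset_Ioo_iff hA] at hAI
  rw [spectrum_subset_Ioo_iff (isHermitian_conjTranspose_mul_mul V hA)]
  refine ⟨?_, ?_⟩
  · convert! hAI.1.conjTranspose_mul_mul_same hinj using 1
    simp [Matrix.mul_sub, Matrix.sub_mul, hV]
  · convert! hAI.2.conjTranspose_mul_mul_same hinj using 1
    simp [Matrix.mul_sub, Matrix.sub_mul, hV]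

end Jensen

/-! ### Operator convexity of the extreme functions -/

section Kernel

/-- The function `t ↦ (t - t₀)² / (a² - (t - t₀) x)`. -/
def kernelFun (t₀ a x t : ℝ) : ℝ := (t - t₀) ^ 2 / (a ^ 2 - (t - t₀) * x)

theorem kernelFun_denom_pos {t₀ a x t : ℝ} (hx : x ∈ Set.Icc (-a) a)
    (ht : t ∈ Set.Ioo (t₀ - a) (t₀ + a)) : 0 < a ^ 2 - (t - t₀) * x := by
  obtain ⟨h1, h2⟩ := hx
  obtain ⟨h3, h4⟩ := ht
  have h5 : |x| ≤ a := abs_le.2 ⟨h1, h2⟩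
  have h6 : |t - t₀| < a := abs_lt.2 ⟨by linarith, by linarith⟩
  have h7 : (t - t₀) * x ≤ |t - t₀| * |x| := (le_abs_self _).trans (abs_mul _ _).le
  nlinarith [abs_nonneg (t - t₀), abs_nonneg x]

/-- With `H = A - t₀` and `P = a² - x H`, the matrix `P` is positive definite and
`kernelFun t₀ a x A = H P⁻¹ H`. -/
theorem cfc_kernelFun {t₀ a x : ℝ} (hx : x ∈ Set.Icc (-a) a) {A : Matrix n n ℂ}
    (hA : A.IsHermitian) (hAI : spectrum ℝ A ⊆ Set.Ioo (t₀ - a) (t₀ + a)) :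
    (a ^ 2 • (1 : Matrix n n ℂ) - x • (A - t₀ • (1 : Matrix n n ℂ))).PosDef ∧
      cfc (kernelFun t₀ a x) A = (A - t₀ • (1 : Matrix n n ℂ))ᴴ *
        (a ^ 2 • (1 : Matrix n n ℂ) - x • (A - t₀ • (1 : Matrix n n ℂ)))⁻¹ *
        (A - t₀ • (1 : Matrix n n ℂ)) := by
  let U : Matrix n n ℂ := hA.eigenvectorUnitary
  have hU : U * Uᴴ = 1 := Unitary.mul_star_self_of_mem hA.eigenvectorUnitary.2
  have hU' : Uᴴ * U = 1 := mul_eq_one_comm.1 hU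
  have hspec : ∀ i, hA.eigenvalues i ∈ Set.Ioo (t₀ - a) (t₀ + a) := fun i =>
    hAI (hA.eigenvalues_mem_spectrum_real i)
  have hcfc : ∀ g : ℝ → ℝ, cfc g A = U * (diagonal fun i => ((g (hA.eigenvalues i) : ℝ) : ℂ)) * Uᴴ :=
    fun g => by rw [hA.cfc_eq]; rfl
  have hsub : A - t₀ • (1 : Matrix n n ℂ) = cfc (fun t => t - t₀) A := by
    simpa [sub_eq_neg_add] using (cfc_affine hA (-t₀) 1).symm
  have hP : a ^ 2 • (1 : Matrix n n ℂ) - x • (A - t₀ • (1 : Matrix n n ℂ)) =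
      cfc (fun t => a ^ 2 - x * (t - t₀)) A := by
    rw [show (fun t => a ^ 2 - x * (t - t₀)) = fun t => (a ^ 2 + x * t₀) + (-x) * t by
      funext t; ring, cfc_affine hA]
    module
  have hpos : ∀ i, 0 < a ^ 2 - x * (hA.eigenvalues i - t₀) := fun i => by
    rw [mul_comm]; exact kernelFun_denom_pos hx (hspec i)
  rw [hP, hsub, hcfc, hcfc, hcfc]
  refine ⟨?_, ?_⟩
  · refine PosDef.mul_mul_conjTranspose_same (.diagonal fun i => by exact_mod_cast hpos i) ?_
    exact vecMul_injective_of_isUnit (IsUnit.of_mul_eq_one _ hU)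
  · have hinv : (U * (diagonal fun i => ((a ^ 2 - x * (hA.eigenvalues i - t₀) : ℝ) : ℂ)) * Uᴴ)⁻¹ =
        U * (diagonal fun i => (((a ^ 2 - x * (hA.eigenvalues i - t₀))⁻¹ : ℝ) : ℂ)) * Uᴴ := by
      refine inv_eq_right_inv ?_
      calc _ = U * ((diagonal fun i => ((a ^ 2 - x * (hA.eigenvalues i - t₀) : ℝ) : ℂ)) * (Uᴴ * U) *
            (diagonal fun i => (((a ^ 2 - x * (hA.eigenvalues i - t₀))⁻¹ : ℝ) : ℂ))) * Uᴴ := by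
              simp only [Matrix.mul_assoc]
        _ = 1 := by
          rw [hU', Matrix.mul_one, diagonal_mul_diagonal]
          simp_rw [← Complex.ofReal_mul, mul_inv_cancel₀ (hpos _).ne']
          simp [hU]
    rw [hinv, conjTranspose_mul, conjTranspose_mul, isHermitian_diagonal_ofReal,
      conjTranspose_conjTranspose]
    symm
    calc _ = U * ((diagonal fun i => ((hA.eigenvalues i - t₀ : ℝ) : ℂ)) * (Uᴴ * U) *
            (diagonal fun i => (((a ^ 2 - x * (hA.eigenvalues i - t₀))⁻¹ : ℝ) : ℂ)) * (Uᴴ * U) *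
            (diagonal fun i => ((hA.eigenvalues i - t₀ : ℝ) : ℂ))) * Uᴴ := by
              simp only [Matrix.mul_assoc]
      _ = _ := by
        rw [hU', Matrix.mul_one, Matrix.mul_one, diagonal_mul_diagonal, diagonal_mul_diagonal]
        congr! 4 with i
        rw [← Complex.ofReal_mul, ← Complex.ofReal_mul, kernelFun]
        congr 1
        rw [mul_comm x]
        ring

/-- The block matrix with rows (P, T) and (Tᴴ, Tᴴ P⁻¹ T) has zero Schur complement, hence is
positive semidefinite. Since P and T are affine in the matrix argument, averaging two such blocks
and taking the Schur complement again gives convexity. -/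
theorem operatorConvexOn_kernelFun {t₀ a x : ℝ} (hx : x ∈ Set.Icc (-a) a) :
    OperatorConvexOn (Set.Ioo (t₀ - a) (t₀ + a)) (kernelFun t₀ a x) := by
  intro k A B hA hB hAI hBI s hs hs'
  have hs'' : 0 ≤ 1 - s := by linarith
  let T : Matrix (Fin k) (Fin k) ℂ → Matrix (Fin k) (Fin k) ℂ := fun M =>
    M - t₀ • (1 : Matrix (Fin k) (Fin k) ℂ)
  let P : Matrix (Fin k) (Fin k) ℂ → Matrix (Fin k) (Fin k) ℂ := fun M =>
    a ^ 2 • (1 : Matrix (Fin k) (Fin k) ℂ) - x • T M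
  have hC : (s • A + (1 - s) • B).IsHermitian :=
    ((IsSelfAdjoint.all s).smul hA.isSelfAdjoint).add
      ((IsSelfAdjoint.all (1 - s)).smul hB.isSelfAdjoint)
  have hCI : spectrum ℝ (s • A + (1 - s) • B) ⊆ Set.Ioo (t₀ - a) (t₀ + a) := by
    -- Scaling preserves positive definiteness only for nonzero weights, so the endpoints are
    -- treated apart.
    rcases hs.eq_or_lt with rfl | h0
    · simpa using hBI
    rcases hs'.eq_or_lt with rfl | h1
    · simpa using hAI
    rw [spectrum_subset_Ioo_iff hA] at hAI
    rw [spectrum_subset_Ioo_iff hB] at hBI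
    rw [spectrum_subset_Ioo_iff hC]
    have h1' : 0 < 1 - s := by linarith
    refine ⟨?_, ?_⟩
    · convert! (hAI.1.smul h0).add (hBI.1.smul h1') using 1
      module
    · convert! (hAI.2.smul h0).add (hBI.2.smul h1') using 1
      module
  obtain ⟨hPA, hfA⟩ := cfc_kernelFun hx hA hAI
  obtain ⟨hPB, hfB⟩ := cfc_kernelFun hx hB hBI
  obtain ⟨hPC, hfC⟩ := cfc_kernelFun hx hC hCI
  have hblock : ∀ M : Matrix (Fin k) (Fin k) ℂ, (P M).PosDef →
      cfc (kernelFun t₀ a x) M = (T M)ᴴ * (P M)⁻¹ * T M →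
      (fromBlocks (P M) (T M) (T M)ᴴ (cfc (kernelFun t₀ a x) M)).PosSemidef := by
    intro M hM h
    let := hM.isUnit.invertible
    rw [hM.fromBlocks₁₁, h, sub_self]
    exact .zero
  have hsum := ((hblock A hPA hfA).smul hs).add ((hblock B hPB hfB).smul hs'')
  rw [fromBlocks_smul, fromBlocks_smul, fromBlocks_add] at hsum
  have hTC : s • T A + (1 - s) • T B = T (s • A + (1 - s) • B) := by
    simp only [T]; module
  have hPCe : s • P A + (1 - s) • P B = P (s • A + (1 - s) • B) := by
    simp only [P, T]; module
  have hTC' : s • (T A)ᴴ + (1 - s) • (T B)ᴴ = (T (s • A + (1 - s) • B))ᴴ := by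
    rw [← hTC, conjTranspose_add, conjTranspose_smul, conjTranspose_smul]; simp
  rw [hTC, hPCe, hTC'] at hsum
  let := hPC.isUnit.invertible
  rw [PosDef.fromBlocks₁₁ _ _ hPC] at hsum
  rw [hfC]
  exact hsum

end Kernel

/-! ### Spectral form of the relative entropy -/

section SpectralForm

theorem kronecker_mulVec_rowVec {ι : Type*} [Fintype ι] (A B M : Matrix ι ι ℂ) :
    (A ⊗ₖ B) *ᵥ rowVec M = rowVec (A * M * Bᵀ) := by
  ext ⟨i, j⟩
  simp only [mulVec, dotProduct, rowVec, Fintype.sum_prod_type, kroneckerMap_apply, mul_apply,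
    transpose_apply, Finset.sum_mul]
  rw [Finset.sum_comm]
  exact Finset.sum_congr rfl fun _ _ => Finset.sum_congr rfl fun _ _ => by ring

theorem cfc_eq_eigenvectorUnitary {A : Matrix n n ℂ} (hA : A.IsHermitian) (g : ℝ → ℝ) :
    cfc g A = (hA.eigenvectorUnitary : Matrix n n ℂ) *
      (diagonal fun i => ((g (hA.eigenvalues i) : ℝ) : ℂ)) *
      (hA.eigenvectorUnitary : Matrix n n ℂ)ᴴ := by
  rw [hA.cfc_eq]; rfl

theorem eq_eigenvectorUnitary {A : Matrix n n ℂ} (hA : A.IsHermitian) :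
    A = (hA.eigenvectorUnitary : Matrix n n ℂ) *
      (diagonal fun i => ((hA.eigenvalues i : ℝ) : ℂ)) *
      (hA.eigenvectorUnitary : Matrix n n ℂ)ᴴ := hA.spectral_theorem

theorem cpow_mul_cpow_one_sub {x y : ℝ} (hx : 0 < x) (hy : 0 < y) (z : ℂ) :
    (y : ℂ) ^ z * (x : ℂ) ^ (-z + 1) = x * ((y * x⁻¹ : ℝ) : ℂ) ^ z := by
  have hx' : (x : ℂ) ≠ 0 := by exact_mod_cast hx.ne'
  rw [Complex.cpow_add _ _ hx', Complex.cpow_one, Complex.ofReal_mul,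
    Complex.mul_cpow_ofReal_nonneg hy.le (inv_pos.2 hx).le, Complex.cpow_neg, Complex.ofReal_inv,
    Complex.inv_cpow _ _ (by rw [Complex.arg_ofReal_of_nonneg hx.le]; exact Real.pi_pos.ne)]
  ring

/-- The relative entropies of a pair `ρ`, `σ`, and the traces `Tr (σ ^ z ρ ^ (1 - z))`, are the
integrals of the respective functions against one finitely supported measure. -/
theorem exists_spectral_weights {ρ σ : Matrix n n ℂ} (hρ : ρ.PosDef) (hσ : σ.PosDef) :
    ∃ c τ : n × n → ℝ, (∀ k, τ k ∈ spectrum ℝ (relMod ρ σ)) ∧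
      (∀ g : ℝ → ℝ, fRelEntropy g ρ σ = ∑ k, c k * g (τ k)) ∧
      ∀ z : ℂ, (mpow σ z * mpow ρ (-z + 1)).trace = ∑ k, (c k : ℂ) * (τ k : ℂ) ^ z := by
  let α := hρ.1.eigenvalues
  let β := hσ.1.eigenvalues
  have hα : ∀ i, 0 < α i := hρ.eigenvalues_pos
  have hβ : ∀ i, 0 < β i := hσ.eigenvalues_pos
  have hαc : ∀ i, (α i : ℂ) ≠ 0 := fun i => by exact_mod_cast (hα i).ne'
  let R : Matrix n n ℂ := hρ.1.eigenvectorUnitary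
  let S : Matrix n n ℂ := hσ.1.eigenvectorUnitary
  have hR : R * Rᴴ = 1 := Unitary.mul_star_self_of_mem hρ.1.eigenvectorUnitary.2
  have hS : S * Sᴴ = 1 := Unitary.mul_star_self_of_mem hσ.1.eigenvectorUnitary.2
  have hR' : Rᴴ * R = 1 := mul_eq_one_comm.1 hR
  let G : Matrix n n ℂ := Sᴴ * R
  -- The atoms are the ratios β_j / α_i of eigenvalues of σ and ρ; their weights are α_i times the
  -- squared overlaps of the eigenvectors.
  let c : n × n → ℝ := fun k => α k.2 * Complex.normSq (G k.1 k.2)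
  let τ : n × n → ℝ := fun k => β k.1 * (α k.2)⁻¹
  let K : Matrix (n × n) (n × n) ℂ := S ⊗ₖ Rᴴᵀ
  have hKH : Kᴴ = Sᴴ ⊗ₖ Rᵀ := by
    rw [conjTranspose_kronecker]
    congr 1
    ext i j
    simp
  have hK : K * Kᴴ = 1 := by
    rw [hKH, ← mul_kronecker_mul, hS, ← transpose_mul, hR, transpose_one, one_kronecker_one]
  have hρinv : ρ⁻¹ = R * (diagonal fun i => (((α i)⁻¹ : ℝ) : ℂ)) * Rᴴ := by
    refine inv_eq_right_inv ?_
    calc ρ * (R * (diagonal fun i => (((α i)⁻¹ : ℝ) : ℂ)) * Rᴴ)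
        = R * (diagonal fun i => (α i : ℂ)) * Rᴴ *
          (R * (diagonal fun i => (((α i)⁻¹ : ℝ) : ℂ)) * Rᴴ) := by
            conv_lhs => rw [eq_eigenvectorUnitary hρ.1]
      _ = R * ((diagonal fun i => (α i : ℂ)) * (Rᴴ * R) *
            (diagonal fun i => (((α i)⁻¹ : ℝ) : ℂ))) * Rᴴ := by simp only [Matrix.mul_assoc]
      _ = 1 := by
        rw [hR', Matrix.mul_one, diagonal_mul_diagonal]
        simp [mul_inv_cancel₀ (hαc _), hR]
  have hrel : relMod ρ σ = K * (diagonal fun k => (τ k : ℂ)) * Kᴴ := by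
    have hd : (diagonal fun k => (τ k : ℂ)) =
        (diagonal fun i => (β i : ℂ)) ⊗ₖ (diagonal fun i => (((α i)⁻¹ : ℝ) : ℂ)) := by
      rw [diagonal_kronecker_diagonal]
      congr 1
      funext k
      simp [τ]
    rw [relMod, hρinv, hKH, hd, ← mul_kronecker_mul, ← mul_kronecker_mul]
    conv_lhs => rw [eq_eigenvectorUnitary hσ.1]
    congr 1
    rw [transpose_mul, transpose_mul, diagonal_transpose, Matrix.mul_assoc]
  refine ⟨c, τ, fun k => ?_, fun g => ?_, fun z => ?_⟩
  · rw [hrel, spectrum_unitary_conj hK, spectrum_diagonal_ofReal]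
    exact ⟨k, rfl⟩
  -- In the eigenbasis `K` of `relMod ρ σ`, the vector vec(√ρ) becomes vec(Sᴴ √ρ R), the matrix `G`
  -- with columns scaled by √α_i.
  · have hv : Kᴴ *ᵥ rowVec (cfc Real.sqrt ρ) = fun k => G k.1 k.2 * (√(α k.2) : ℝ) := by
      rw [hKH, kronecker_mulVec_rowVec, transpose_transpose, cfc_eq_eigenvectorUnitary hρ.1]
      have : Sᴴ * (R * (diagonal fun i => ((√(α i) : ℝ) : ℂ)) * Rᴴ) * R =
          G * (diagonal fun i => ((√(α i) : ℝ) : ℂ)) := by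
        calc _ = Sᴴ * R * (diagonal fun i => ((√(α i) : ℝ) : ℂ)) * (Rᴴ * R) := by
              simp only [Matrix.mul_assoc]
          _ = _ := by rw [hR', Matrix.mul_one]
      funext k
      simp only [rowVec]
      rw [this, mul_diagonal]
    rw [fRelEntropy, hrel, cfc_unitary_conj (isHermitian_diagonal_ofReal τ) hK,
      cfc_diagonal_ofReal, ← mulVec_mulVec, ← mulVec_mulVec, hv, dotProduct_mulVec,
      ← conjTranspose_conjTranspose K, ← star_mulVec, hv]
    simp only [dotProduct, mulVec_diagonal, Pi.star_apply, Complex.re_sum]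
    refine Finset.sum_congr rfl fun k _ => ?_
    have : star (G k.1 k.2 * (√(α k.2) : ℝ)) * ((g (τ k) : ℝ) * (G k.1 k.2 * (√(α k.2) : ℝ))) =
        ((c k * g (τ k) : ℝ) : ℂ) := by
      have h1 : ((√(α k.2) : ℝ) : ℂ) * (√(α k.2) : ℝ) = (α k.2 : ℝ) := by
        rw [← Complex.ofReal_mul, Real.mul_self_sqrt (hα _).le]
      have h2 : star (G k.1 k.2) * G k.1 k.2 = (Complex.normSq (G k.1 k.2) : ℂ) :=
        (Complex.normSq_eq_conj_mul_self).symm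
      simp only [c, star_mul', Complex.ofReal_mul, ← h1, ← h2, Complex.star_def, Complex.conj_ofReal]
      ring
    rw [this, Complex.ofReal_re]
  · rw [mpow_eq hσ.1, mpow_eq hρ.1]
    have : ∀ D E : Matrix n n ℂ, (S * D * star S * (R * E * star R)).trace =
        (D * G * (E * Gᴴ)).trace := fun D E => by
      rw [show S * D * star S * (R * E * star R) = S * (D * star S * (R * E * star R)) by
        simp only [Matrix.mul_assoc], trace_mul_comm]
      congr 1
      simp only [G, conjTranspose_mul, conjTranspose_conjTranspose, star_eq_conjTranspose,
        Matrix.mul_assoc]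
    rw [this, trace, Fintype.sum_prod_type]
    refine Finset.sum_congr rfl fun j _ => ?_
    rw [diag_apply, mul_apply]
    refine Finset.sum_congr rfl fun i _ => ?_
    rw [diagonal_mul, diagonal_mul, conjTranspose_apply]
    have h2 : G j i * star (G j i) = (Complex.normSq (G j i) : ℂ) := Complex.mul_conj _
    have h3 := cpow_mul_cpow_one_sub (hα i) (hβ j) z
    simp only [c, τ, Complex.ofReal_mul] at h3 ⊢
    linear_combination (G j i * star (G j i)) * h3 + (α i : ℂ) * ((β j : ℂ) * ((α i)⁻¹ : ℝ)) ^ z * h2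

end SpectralForm

/-! ### Joint convexity -/

section JointConvexity

theorem isHermitian_cfc (g : ℝ → ℝ) (A : Matrix n n ℂ) : (cfc g A)ᴴ = cfc g A :=
  (cfc_predicate g A : IsSelfAdjoint (cfc g A))

theorem cfc_sqrt_mul_self {A : Matrix n n ℂ} (hA : A.PosDef) :
    cfc Real.sqrt A * cfc Real.sqrt A = A := by
  rw [← cfc_mul Real.sqrt Real.sqrt A (by fun_prop) (by fun_prop)]
  conv_rhs => rw [← cfc_id' ℝ A hA.1.isSelfAdjoint]
  refine cfc_congr fun x hx => ?_
  rw [hA.1.spectrum_real_eq_range_eigenvalues] at hx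
  obtain ⟨i, rfl⟩ := hx
  exact Real.mul_self_sqrt (hA.eigenvalues_pos i).le

theorem isHermitian_relMod {ρ σ : Matrix n n ℂ} (hρ : ρ.PosDef) (hσ : σ.PosDef) :
    (relMod ρ σ).IsHermitian := by
  have h := hρ.1.inv.transpose
  rw [IsHermitian, relMod, conjTranspose_kronecker, hσ.1, h]

/-- The relative modular operator of a convex combination is a compression of the direct sum of
the relative modular operators. -/
theorem exists_isometry_relMod {ρ₁ ρ₂ σ₁ σ₂ : Matrix n n ℂ} (hρ₁ : ρ₁.PosDef) (hρ₂ : ρ₂.PosDef)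
    {l : ℝ} (hl0 : 0 < l) (hl1 : l < 1) :
    ∃ V : Matrix (n × n ⊕ n × n) (n × n) ℂ, Vᴴ * V = 1 ∧
      (∀ M N : Matrix (n × n) (n × n) ℂ, ∀ v, v = rowVec (cfc Real.sqrt (l • ρ₁ + (1 - l) • ρ₂)) →
        star v ⬝ᵥ ((Vᴴ * fromBlocks M 0 0 N * V) *ᵥ v) =
          l * (star (rowVec (cfc Real.sqrt ρ₁)) ⬝ᵥ (M *ᵥ rowVec (cfc Real.sqrt ρ₁))) +
          (1 - l : ℝ) * (star (rowVec (cfc Real.sqrt ρ₂)) ⬝ᵥ (N *ᵥ rowVec (cfc Real.sqrt ρ₂)))) ∧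
      Vᴴ * fromBlocks (relMod ρ₁ σ₁) 0 0 (relMod ρ₂ σ₂) * V =
        relMod (l • ρ₁ + (1 - l) • ρ₂) (l • σ₁ + (1 - l) • σ₂) := by
  have hl : 0 < 1 - l := by linarith
  have hρ : (l • ρ₁ + (1 - l) • ρ₂).PosDef := (hρ₁.smul hl0).add (hρ₂.smul hl)
  generalize hρe : l • ρ₁ + (1 - l) • ρ₂ = ρ at hρ
  let T := cfc Real.sqrt ρ
  have hTT : T * T = ρ := cfc_sqrt_mul_self hρ
  have hTu : IsUnit T := isUnit_of_mul_isUnit_left (hTT ▸ hρ.isUnit)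
  have hTi : T * T⁻¹ = 1 := mul_nonsing_inv T ((isUnit_iff_isUnit_det T).1 hTu)
  have hTi' : T⁻¹ * T = 1 := nonsing_inv_mul T ((isUnit_iff_isUnit_det T).1 hTu)
  have hTH : (T⁻¹)ᴴ = T⁻¹ := by rw [conjTranspose_nonsing_inv, isHermitian_cfc]
  let W : ℝ → Matrix n n ℂ → Matrix (n × n) (n × n) ℂ := fun s A =>
    √s • ((1 : Matrix n n ℂ) ⊗ₖ (T⁻¹ * cfc Real.sqrt A)ᵀ)
  have htc : ∀ M : Matrix n n ℂ, Mᵀᴴ = Mᴴᵀ := fun _ => rfl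
  have hWH : ∀ s A, (W s A)ᴴ = √s • ((1 : Matrix n n ℂ) ⊗ₖ (cfc Real.sqrt A * T⁻¹)ᵀ) := by
    intro s A
    simp only [W]
    rw [conjTranspose_smul, conjTranspose_kronecker, conjTranspose_one, star_trivial,
      htc, conjTranspose_mul, hTH, isHermitian_cfc]
  have hWconj : ∀ s, 0 ≤ s → ∀ A P Q : Matrix n n ℂ, (W s A)ᴴ * (P ⊗ₖ Qᵀ) * W s A =
      s • (P ⊗ₖ (T⁻¹ * (cfc Real.sqrt A * Q * cfc Real.sqrt A) * T⁻¹)ᵀ) := by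
    intro s hs A P Q
    rw [hWH]
    simp only [W]
    rw [smul_mul_assoc, smul_mul_assoc, mul_smul_comm, smul_smul, Real.mul_self_sqrt hs,
      ← mul_kronecker_mul, ← mul_kronecker_mul, Matrix.one_mul, Matrix.mul_one, ← transpose_mul,
      ← transpose_mul]
    simp only [Matrix.mul_assoc]
  have hWv : ∀ s A, W s A *ᵥ rowVec T = √s • rowVec (cfc Real.sqrt A) := by
    intro s A
    simp only [W]
    rw [smul_mulVec, kronecker_mulVec_rowVec, transpose_transpose, Matrix.one_mul,
      ← Matrix.mul_assoc, hTi, Matrix.one_mul]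
  have hVconj : ∀ M N : Matrix (n × n) (n × n) ℂ,
      (fromRows (W l ρ₁) (W (1 - l) ρ₂))ᴴ * fromBlocks M 0 0 N *
        fromRows (W l ρ₁) (W (1 - l) ρ₂) =
      (W l ρ₁)ᴴ * M * W l ρ₁ + (W (1 - l) ρ₂)ᴴ * N * W (1 - l) ρ₂ := by
    intro M N
    rw [conjTranspose_fromRows_eq_fromCols_conjTranspose, fromCols_mul_fromBlocks,
      fromCols_mul_fromRows]
    simp
  refine ⟨fromRows (W l ρ₁) (W (1 - l) ρ₂), ?_, ?_, ?_⟩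
  -- The right tensor factor of VᴴV is the transpose of T⁻¹ρT⁻¹, which is 1 because T² = ρ.
  · have hTρ : l • (T⁻¹ * ρ₁ * T⁻¹) + (1 - l) • (T⁻¹ * ρ₂ * T⁻¹) = 1 := by
      calc _ = T⁻¹ * (l • ρ₁ + (1 - l) • ρ₂) * T⁻¹ := by
            simp only [Matrix.mul_add, Matrix.add_mul, mul_smul_comm, smul_mul_assoc]
        _ = 1 := by rw [hρe, ← hTT, ← Matrix.mul_assoc, hTi', Matrix.one_mul, hTi]
    have h1 := hVconj 1 1
    rw [fromBlocks_one, Matrix.mul_one] at h1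
    rw [h1, ← one_kronecker_one, ← transpose_one (n := n) (α := ℂ), hWconj l hl0.le,
      hWconj _ hl.le, Matrix.mul_one, Matrix.mul_one, cfc_sqrt_mul_self hρ₁, cfc_sqrt_mul_self hρ₂,
      ← kronecker_smul, ← kronecker_smul, ← kronecker_add, ← transpose_smul, ← transpose_smul,
      ← transpose_add, hTρ]
  · rintro M N _ rfl
    have hq : ∀ s, 0 ≤ s → ∀ A : Matrix n n ℂ, ∀ M : Matrix (n × n) (n × n) ℂ,
        star (rowVec T) ⬝ᵥ (((W s A)ᴴ * M * W s A) *ᵥ rowVec T) =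
        s * (star (rowVec (cfc Real.sqrt A)) ⬝ᵥ (M *ᵥ rowVec (cfc Real.sqrt A))) := by
      intro s hs A M
      rw [← mulVec_mulVec, ← mulVec_mulVec, dotProduct_mulVec, ← star_mulVec, hWv, mulVec_smul,
        star_smul, star_trivial, smul_dotProduct, dotProduct_smul, smul_smul, Real.mul_self_sqrt hs,
        Complex.real_smul]
    rw [hVconj, add_mulVec, dotProduct_add, hq l hl0.le, hq _ hl.le]
  -- Since √A A⁻¹ √A = 1, both summands carry the same right factor T⁻² = ρ⁻¹, and only the σ's get
  -- averaged.
  · have hinv : ∀ A : Matrix n n ℂ, A.PosDef →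
        T⁻¹ * (cfc Real.sqrt A * A⁻¹ * cfc Real.sqrt A) * T⁻¹ = ρ⁻¹ := by
      intro A hA
      have hs := cfc_sqrt_mul_self hA
      have hu : IsUnit (cfc Real.sqrt A) := isUnit_of_mul_isUnit_left (hs ▸ hA.isUnit)
      have hd := (isUnit_iff_isUnit_det _).1 hu
      have : cfc Real.sqrt A * A⁻¹ * cfc Real.sqrt A = 1 := by
        conv_lhs => enter [1, 2]; rw [← hs]
        rw [Matrix.mul_inv_rev, ← Matrix.mul_assoc, mul_nonsing_inv _ hd, Matrix.one_mul,
          nonsing_inv_mul _ hd]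
      rw [this, Matrix.mul_one, ← Matrix.mul_inv_rev, hTT]
    rw [hVconj]
    simp only [relMod]
    rw [hWconj l hl0.le, hWconj _ hl.le, hinv _ hρ₁, hinv _ hρ₂, ← smul_kronecker,
      ← smul_kronecker, ← add_kronecker]

theorem spectrum_relMod_convexComb_subset {u v : ℝ} {ρ₁ ρ₂ σ₁ σ₂ : Matrix n n ℂ}
    (hρ₁ : ρ₁.PosDef) (hρ₂ : ρ₂.PosDef) (hσ₁ : σ₁.PosDef) (hσ₂ : σ₂.PosDef)
    (hs₁ : spectrum ℝ (relMod ρ₁ σ₁) ⊆ Set.Ioo u v) (hs₂ : spectrum ℝ (relMod ρ₂ σ₂) ⊆ Set.Ioo u v)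
    {l : ℝ} (hl0 : 0 < l) (hl1 : l < 1) :
    spectrum ℝ (relMod (l • ρ₁ + (1 - l) • ρ₂) (l • σ₁ + (1 - l) • σ₂)) ⊆ Set.Ioo u v := by
  obtain ⟨V, hV, -, hrel⟩ :=
    exists_isometry_relMod (σ₁ := σ₁) (σ₂ := σ₂) hρ₁ hρ₂ hl0 hl1
  rw [← hrel]
  refine spectrum_compression_subset
    (IsHermitian.fromBlocks (isHermitian_relMod hρ₁ hσ₁) (by simp) (isHermitian_relMod hρ₂ hσ₂))
    ?_ hV
  rw [spectrum_fromBlocks_diag]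
  exact Set.union_subset hs₁ hs₂

theorem fRelEntropy_jointly_convex {I : Set ℝ} {f : ℝ → ℝ} (hf : OperatorConvexOn I f)
    {ρ₁ ρ₂ σ₁ σ₂ : Matrix n n ℂ}
    (hρ₁ : ρ₁.PosDef) (hρ₂ : ρ₂.PosDef) (hσ₁ : σ₁.PosDef) (hσ₂ : σ₂.PosDef)
    (hs₁ : spectrum ℝ (relMod ρ₁ σ₁) ⊆ I) (hs₂ : spectrum ℝ (relMod ρ₂ σ₂) ⊆ I)
    {l : ℝ} (hl0 : 0 < l) (hl1 : l < 1) :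
    fRelEntropy f (l • ρ₁ + (1 - l) • ρ₂) (l • σ₁ + (1 - l) • σ₂) ≤
      l * fRelEntropy f ρ₁ σ₁ + (1 - l) * fRelEntropy f ρ₂ σ₂ := by
  obtain ⟨V, hV, hquad, hrel⟩ :=
    exists_isometry_relMod (σ₁ := σ₁) (σ₂ := σ₂) hρ₁ hρ₂ hl0 hl1
  have h₁ := isHermitian_relMod hρ₁ hσ₁
  have h₂ := isHermitian_relMod hρ₂ hσ₂
  have h₁₂ : (fromBlocks (relMod ρ₁ σ₁) 0 0 (relMod ρ₂ σ₂)).IsHermitian :=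
    IsHermitian.fromBlocks h₁ (by simp) h₂
  have h := posSemidef_compression_sub hf h₁₂
    (by rw [spectrum_fromBlocks_diag]; exact Set.union_subset hs₁ hs₂) hV
  rw [cfc_fromBlocks_diag h₁ h₂, hrel] at h
  have h' := h.re_dotProduct_nonneg (rowVec (cfc Real.sqrt (l • ρ₁ + (1 - l) • ρ₂)))
  rw [sub_mulVec, dotProduct_sub, hquad _ _ _ rfl] at h'
  simp only [RCLike.re_to_complex, Complex.sub_re, Complex.add_re, Complex.re_ofReal_mul] at h'
  simp only [fRelEntropy]
  linarith

end JointConvexity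

/-! ### Finitely supported signed measures -/

section FinitelySupported

variable {ι : Type*} [Fintype ι]

/-- The points `τ k` may repeat, so the mass of the measure at `s` is the sum of the weights over
the fiber of `s`. -/
theorem sum_image_fiberwise (w τ : ι → ℝ) (g : ℝ → ℂ) :
    ∑ s ∈ Finset.univ.image τ, ((∑ k with τ k = s, w k : ℝ) : ℂ) * g s =
      ∑ k, (w k : ℂ) * g (τ k) := by
  rw [← Finset.sum_fiberwise_of_maps_to (s := Finset.univ) (t := Finset.univ.image τ) (g := τ)
    fun k hk => Finset.mem_image_of_mem τ hk]
  refine Finset.sum_congr rfl fun s _ => ?_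
  rw [Complex.ofReal_sum, Finset.sum_mul]
  refine Finset.sum_congr rfl fun k hk => ?_
  rw [(Finset.mem_filter.1 hk).2]

theorem sum_image_fiberwise_real (w τ : ι → ℝ) (g : ℝ → ℝ) :
    ∑ s ∈ Finset.univ.image τ, (∑ k with τ k = s, w k) * g s = ∑ k, w k * g (τ k) := by
  have h := sum_image_fiberwise w τ fun t => (g t : ℂ)
  exact_mod_cast h

/-- Vanishing moments kill every polynomial, in particular one interpolating the indicator of `s` on
the support. -/
theorem fiber_sum_eq_zero_of_moments {w τ : ι → ℝ} (h : ∀ m : ℕ, ∑ k, w k * τ k ^ m = 0) (s : ℝ) :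
    ∑ k with τ k = s, w k = 0 := by
  obtain ⟨p, hp⟩ := exists_polynomial_eq_on (fun x => if x = s then 1 else 0) (Set.finite_range τ)
  have hsum : ∑ k, w k * p.eval (τ k) = 0 := by
    simp_rw [Polynomial.eval_eq_sum_range, Finset.mul_sum]
    rw [Finset.sum_comm]
    refine Finset.sum_eq_zero fun m _ => ?_
    rw [← mul_zero (p.coeff m), ← h m, Finset.mul_sum]
    exact Finset.sum_congr rfl fun k _ => by ring
  rw [Finset.sum_filter]
  refine Eq.trans (Finset.sum_congr rfl fun k _ => ?_) hsum
  rw [hp _ ⟨k, rfl⟩, mul_ite, mul_one, mul_zero]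

/-- As a function of `x` the sum is rational; infinitely many zeros make its numerator the zero
polynomial, and evaluating that at the pole of one atom isolates the mass there. -/
theorem fiber_sum_eq_zero_of_kernelFun {w τ : ι → ℝ} {t₀ a : ℝ} (ha : 0 < a)
    (hτ : ∀ k, τ k ∈ Set.Ioo (t₀ - a) (t₀ + a)) (hw : ∑ k, w k = 0)
    (h : {x ∈ Set.Icc (-a) a | ∑ k, w k * kernelFun t₀ a x (τ k) = 0}.Infinite) (s : ℝ) :
    ∑ k with τ k = s, w k = 0 := by
  set S := Finset.univ.image τ with hS
  set ν : ℝ → ℝ := fun s => ∑ k with τ k = s, w k with hν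
  let q : ℝ → Polynomial ℝ := fun s =>
    Polynomial.C (a ^ 2) - Polynomial.C (s - t₀) * Polynomial.X
  have hq : ∀ s x, (q s).eval x = a ^ 2 - (s - t₀) * x := fun s x => by simp [q]
  -- The numerator: the kernel sum multiplied by all the denominators `q s`.
  let P : Polynomial ℝ := ∑ s ∈ S, Polynomial.C (ν s * (s - t₀) ^ 2) * ∏ r ∈ S.erase s, q r
  have hP : P = 0 := by
    refine Polynomial.eq_zero_of_infinite_isRoot P (h.mono ?_)
    rintro x ⟨hx, hx0⟩
    have hpos : ∀ s ∈ S, (q s).eval x ≠ 0 := by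
      intro s hs
      obtain ⟨k, -, rfl⟩ := Finset.mem_image.1 hs
      rw [hq]
      exact (kernelFun_denom_pos hx (hτ k)).ne'
    rw [← sum_image_fiberwise_real w τ (kernelFun t₀ a x)] at hx0
    have : P.eval x = (∏ r ∈ S, (q r).eval x) * ∑ s ∈ S, ν s * kernelFun t₀ a x s := by
      simp only [P, Polynomial.eval_finsetSum, Polynomial.eval_mul, Polynomial.eval_C,
        Polynomial.eval_prod, Finset.mul_sum]
      refine Finset.sum_congr rfl fun s hs => ?_
      have h1 := hpos s hs
      rw [← Finset.mul_prod_erase S _ hs, kernelFun, ← hq]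
      field_simp
    exact this.trans (by rw [hx0, mul_zero])
  have hne : ∀ s, s ≠ t₀ → ν s = 0 := by
    intro s hs
    by_cases hsS : s ∈ S
    · have hs' : s - t₀ ≠ 0 := sub_ne_zero.2 hs
      -- This point is the root of `q s`, so only the summand omitting that factor survives.
      have h1 : P.eval (a ^ 2 / (s - t₀)) = 0 := by rw [hP, Polynomial.eval_zero]
      simp only [P, Polynomial.eval_finsetSum, Polynomial.eval_mul, Polynomial.eval_C,
        Polynomial.eval_prod] at h1
      rw [Finset.sum_eq_single_of_mem s hsS] at h1
      · refine (mul_eq_zero.1 ((mul_eq_zero.1 h1).resolve_right ?_)).resolve_right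
          (pow_ne_zero 2 hs')
        refine Finset.prod_ne_zero_iff.2 fun r hr => ?_
        have hrs : s - r ≠ 0 := sub_ne_zero.2 (Finset.ne_of_mem_erase hr).symm
        rw [hq, show a ^ 2 - (r - t₀) * (a ^ 2 / (s - t₀)) = a ^ 2 * (s - r) / (s - t₀) by
          field_simp; ring]
        positivity
      · intro r _ hrs
        rw [Finset.prod_eq_zero (Finset.mem_erase.2 ⟨hrs.symm, hsS⟩), mul_zero]
        rw [hq]
        field_simp
        ring
    · refine Finset.sum_eq_zero fun k hk => ?_
      exact absurd (Finset.mem_image.2 ⟨k, Finset.mem_univ k, (Finset.mem_filter.1 hk).2⟩) hsS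
  -- The kernels vanish at t₀ and cannot see an atom there; the zero total mass removes it.
  by_cases hs : s = t₀
  · have h1 := sum_image_fiberwise_real w τ fun _ => 1
    simp only [mul_one, hw] at h1
    by_cases hsS : s ∈ S
    · rwa [Finset.sum_eq_single_of_mem s hsS fun r _ hr => hne r (hs ▸ hr)] at h1
    · refine Finset.sum_eq_zero fun k hk => ?_
      exact absurd (Finset.mem_image.2 ⟨k, Finset.mem_univ k, (Finset.mem_filter.1 hk).2⟩) hsS
  · exact hne s hs

end FinitelySupported

/-! ### Vanishing of the signed measure when the defect of a diffused function is zero -/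

section Diffused

/-- `F` vanishes μ-almost everywhere, so the non-zeros of `F` in [u, v] form a μ-null set, on which
the density is zero almost everywhere. As the density is positive there, this set is Lebesgue null,
and finitely many zeros cannot make up the rest of [u, v]. -/
theorem infinite_zeros_of_integral_eq_zero {μ : Measure ℝ} [IsFiniteMeasure μ] {F : ℝ → ℝ}
    (hF : Integrable F μ) (hF0 : 0 ≤ᵐ[μ] F) (hint : ∫ x, F x ∂μ = 0) {u v : ℝ} (huv : u < v)
    (hd : ∀ᵐ x ∂(volume.restrict (Set.Icc u v)), 0 < μ.rnDeriv volume x) :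
    {x ∈ Set.Icc u v | F x = 0}.Infinite := by
  intro hfin
  have h0 : μ {x | F x ≠ 0} = 0 := by
    have := (integral_eq_zero_iff_of_nonneg_ae hF0 hF).1 hint
    exact ae_iff.1 this
  have hsub : Set.Icc u v \ {x ∈ Set.Icc u v | F x = 0} ⊆ {x | F x ≠ 0} :=
    fun x hx h => hx.2 ⟨hx.1, h⟩
  set N := Set.Icc u v \ {x ∈ Set.Icc u v | F x = 0} with hN
  have h1 : ∫⁻ x in N, μ.rnDeriv volume x = 0 :=
    le_antisymm ((Measure.setLIntegral_rnDeriv_le N).trans (measure_mono_null hsub h0).le) zero_le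
  have h2 := (lintegral_eq_zero_iff (Measure.measurable_rnDeriv μ volume)).1 h1
  have h3 : ∀ᵐ x ∂(volume.restrict N), 0 < μ.rnDeriv volume x :=
    ae_mono (Measure.restrict_mono Set.sdiff_subset le_rfl) hd
  have h4 : ∀ᵐ _ ∂(volume.restrict N), False := by
    filter_upwards [h2, h3] with x hx hx'
    exact hx'.ne' hx
  have h5 : volume N = 0 := by
    rw [← Measure.restrict_apply_univ]
    simpa [ae_iff] using h4
  have h6 : volume (Set.Icc u v) = 0 :=
    measure_mono_null (t := N ∪ {x ∈ Set.Icc u v | F x = 0})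
      (fun x hx => by
        by_cases h : F x = 0
        · exact .inr ⟨hx, h⟩
        · exact .inl ⟨hx, fun h' => h h'.2⟩)
      (measure_union_null h5 (hfin.measure_zero _))
  rw [Real.volume_Icc, ENNReal.ofReal_eq_zero] at h6
  linarith

theorem integrable_kernelFun {t₀ a t : ℝ} (ht : t ∈ Set.Ioo (t₀ - a) (t₀ + a)) {μ : Measure ℝ}
    [IsFiniteMeasure μ] (hμ : μ (Set.Icc (-a) a)ᶜ = 0) :
    Integrable (fun x => kernelFun t₀ a x t) μ := by
  have hr : μ.restrict (Set.Icc (-a) a) = μ := Measure.restrict_eq_self_of_ae_mem hμ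
  rw [← hr]
  refine ContinuousOn.integrableOn_compact isCompact_Icc ?_
  exact ContinuousOn.div (by fun_prop) (by fun_prop) fun x hx => (kernelFun_denom_pos hx ht).ne'

theorem fiber_sum_eq_zero_of_diffusedOn {ι : Type*} [Fintype ι] {w τ : ι → ℝ} {I : Set ℝ}
    {f : ℝ → ℝ} (hf : DiffusedOn I f)
    (hτ : ∀ u v, I = Set.Ioo u v → ∀ k, τ k ∈ Set.Ioo u v) (hw₀ : ∑ k, w k = 0)
    (hw₁ : ∑ k, w k * τ k = 0)
    (hconv : ∀ g : ℝ → ℝ, OperatorConvexOn I g → 0 ≤ ∑ k, w k * g (τ k))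
    (h : ∑ k, w k * f (τ k) = 0) (s : ℝ) : ∑ k with τ k = s, w k = 0 := by
  obtain ⟨t₀, a, b, c, d, μ, ha, hI, hd, hμp, hμ, hrep, u, v, hu, -, -, hv, huv, hdens⟩ := hf
  have hτ := hτ _ _ hI
  have hint : ∀ k, Integrable (fun x => w k * kernelFun t₀ a x (τ k)) μ := fun k =>
    (integrable_kernelFun (hτ k) hμ).const_mul _
  -- The affine part b + ct drops out by `hw₀` and `hw₁`.
  have hsum : ∑ k, w k * f (τ k) = d * ∫ x, ∑ k, w k * kernelFun t₀ a x (τ k) ∂μ := by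
    rw [integral_finsetSum _ fun k _ => hint k, Finset.mul_sum]
    have h1 : ∀ k, w k * f (τ k) = b * w k + c * (w k * τ k) +
        d * ∫ x, w k * kernelFun t₀ a x (τ k) ∂μ := fun k => by
      rw [hrep _ (hI ▸ hτ k), integral_const_mul]
      simp only [kernelFun]
      ring
    simp_rw [h1, Finset.sum_add_distrib, ← Finset.mul_sum, hw₀, hw₁]
    ring
  rw [h] at hsum
  have hzero := (mul_eq_zero.1 hsum.symm).resolve_left hd.ne'
  have hpos : 0 ≤ᵐ[μ] fun x => ∑ k, w k * kernelFun t₀ a x (τ k) := by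
    filter_upwards [show ∀ᵐ x ∂μ, x ∈ Set.Icc (-a) a from hμ] with x hx
    exact hconv _ (hI ▸ operatorConvexOn_kernelFun hx)
  have hinf := infinite_zeros_of_integral_eq_zero (integrable_finsetSum _ fun k _ => hint k)
    hpos hzero huv hdens
  refine fiber_sum_eq_zero_of_kernelFun ha hτ hw₀ (hinf.mono ?_) s
  exact fun x hx => ⟨⟨hu.trans hx.1.1, hx.1.2.trans hv⟩, hx.2⟩

end Diffused

/-! ### The signed measure of the convexity defect -/

section Defect

theorem mpow_zero {A : Matrix n n ℂ} (hA : A.IsHermitian) : mpow A 0 = 1 := by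
  rw [mpow_eq hA]
  simp

theorem mpow_one {A : Matrix n n ℂ} (hA : A.IsHermitian) : mpow A 1 = A := by
  rw [mpow_eq hA]
  simp only [Complex.cpow_one]
  exact (eq_eigenvectorUnitary hA).symm

/-- The defects of joint convexity, for all functions, and those of the trace identities, are the
integrals of the respective functions against one finitely supported signed measure. -/
theorem exists_defect_weights {ρ₁ ρ₂ σ₁ σ₂ : Matrix n n ℂ}
    (hρ₁ : ρ₁.PosDef) (hρ₂ : ρ₂.PosDef) (hσ₁ : σ₁.PosDef) (hσ₂ : σ₂.PosDef)
    {l : ℝ} (hl0 : 0 < l) (hl1 : l < 1) :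
    ∃ w τ : (n × n ⊕ n × n) ⊕ n × n → ℝ,
      (∀ u v, spectrum ℝ (relMod ρ₁ σ₁) ⊆ Set.Ioo u v → spectrum ℝ (relMod ρ₂ σ₂) ⊆ Set.Ioo u v →
        ∀ k, τ k ∈ Set.Ioo u v) ∧
      (∀ g : ℝ → ℝ, ∑ k, w k * g (τ k) =
        l * fRelEntropy g ρ₁ σ₁ + (1 - l) * fRelEntropy g ρ₂ σ₂ -
          fRelEntropy g (l • ρ₁ + (1 - l) • ρ₂) (l • σ₁ + (1 - l) • σ₂)) ∧
      ∀ z : ℂ, ∑ k, (w k : ℂ) * (τ k : ℂ) ^ z =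
        (l : ℂ) * (mpow σ₁ z * mpow ρ₁ (-z + 1)).trace +
          (1 - (l : ℂ)) * (mpow σ₂ z * mpow ρ₂ (-z + 1)).trace -
          (mpow (l • σ₁ + (1 - l) • σ₂) z * mpow (l • ρ₁ + (1 - l) • ρ₂) (-z + 1)).trace := by
  have hl : 0 < 1 - l := by linarith
  obtain ⟨c₁, τ₁, hm₁, hS₁, hT₁⟩ := exists_spectral_weights hρ₁ hσ₁
  obtain ⟨c₂, τ₂, hm₂, hS₂, hT₂⟩ := exists_spectral_weights hρ₂ hσ₂
  obtain ⟨c₃, τ₃, hm₃, hS₃, hT₃⟩ :=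
    exists_spectral_weights ((hρ₁.smul hl0).add (hρ₂.smul hl)) ((hσ₁.smul hl0).add (hσ₂.smul hl))
  refine ⟨Sum.elim (Sum.elim (fun k => l * c₁ k) fun k => (1 - l) * c₂ k) fun k => -c₃ k,
    Sum.elim (Sum.elim τ₁ τ₂) τ₃, fun u v h₁ h₂ => ?_, fun g => ?_, fun z => ?_⟩
  · rintro ((k | k) | k)
    · exact h₁ (hm₁ k)
    · exact h₂ (hm₂ k)
    · exact spectrum_relMod_convexComb_subset hρ₁ hρ₂ hσ₁ hσ₂ h₁ h₂ hl0 hl1 (hm₃ k)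
  · rw [hS₁, hS₂, hS₃]
    simp [Fintype.sum_sum_type, Finset.mul_sum, mul_assoc, sub_eq_add_neg]
  · rw [hT₁, hT₂, hT₃]
    simp [Fintype.sum_sum_type, Finset.mul_sum, mul_assoc, sub_eq_add_neg]

end Defect

end QuantumFRel

end

theorem lemma6 {n : Type*} [Fintype n] [DecidableEq n]
    (I : Set ℝ) (hI : I.OrdConnected) (f : ℝ → ℝ) (hf : QuantumFRel.OperatorConvexOn I f)
    (ρ₁ ρ₂ σ₁ σ₂ : Matrix n n ℂ)
    (hρ₁ : ρ₁.PosDef) (hρ₂ : ρ₂.PosDef) (hσ₁ : σ₁.PosDef) (hσ₂ : σ₂.PosDef)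
    (hs₁ : spectrum ℝ (QuantumFRel.relMod ρ₁ σ₁) ⊆ I)
    (hs₂ : spectrum ℝ (QuantumFRel.relMod ρ₂ σ₂) ⊆ I)
    (l : ℝ) (hl0 : 0 < l) (hl1 : l < 1) :
    QuantumFRel.fRelEntropy f (l • ρ₁ + (1 - l) • ρ₂) (l • σ₁ + (1 - l) • σ₂) ≤
        l * QuantumFRel.fRelEntropy f ρ₁ σ₁ + (1 - l) * QuantumFRel.fRelEntropy f ρ₂ σ₂ ∧
      (¬ QuantumFRel.AffineOn I f → QuantumFRel.DiffusedOn I f →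
        (QuantumFRel.fRelEntropy f (l • ρ₁ + (1 - l) • ρ₂) (l • σ₁ + (1 - l) • σ₂) =
            l * QuantumFRel.fRelEntropy f ρ₁ σ₁ + (1 - l) * QuantumFRel.fRelEntropy f ρ₂ σ₂ ↔
          ∀ t : ℂ,
            (QuantumFRel.mpow (l • σ₁ + (1 - l) • σ₂) (Complex.I * t) *
                QuantumFRel.mpow (l • ρ₁ + (1 - l) • ρ₂) (-(Complex.I * t) + 1)).trace =
              (l : ℂ) * (QuantumFRel.mpow σ₁ (Complex.I * t) *
                QuantumFRel.mpow ρ₁ (-(Complex.I * t) + 1)).trace +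
              (1 - (l : ℂ)) * (QuantumFRel.mpow σ₂ (Complex.I * t) *
                QuantumFRel.mpow ρ₂ (-(Complex.I * t) + 1)).trace)) := by
  refine ⟨QuantumFRel.fRelEntropy_jointly_convex hf hρ₁ hρ₂ hσ₁ hσ₂ hs₁ hs₂ hl0 hl1,
    fun _ hdiff => ?_⟩
  obtain ⟨w, τ, hτ, hS, hT⟩ := QuantumFRel.exists_defect_weights hρ₁ hρ₂ hσ₁ hσ₂ hl0 hl1
  have hl : 0 < 1 - l := by linarith
  have hρ : (l • ρ₁ + (1 - l) • ρ₂).PosDef := (hρ₁.smul hl0).add (hρ₂.smul hl)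
  have hσ : (l • σ₁ + (1 - l) • σ₂).PosDef := (hσ₁.smul hl0).add (hσ₂.smul hl)
  -- At z = 0 and z = 1 the traces are Tr ρ and Tr σ, which are linear, so the mass and the first
  -- moment are zero.
  have hw₀ : ∑ k, w k = 0 := by
    have h := hT 0
    simp only [neg_zero, zero_add, QuantumFRel.mpow_zero hσ₁.1, QuantumFRel.mpow_zero hσ₂.1,
      QuantumFRel.mpow_zero hσ.1, QuantumFRel.mpow_one hρ₁.1, QuantumFRel.mpow_one hρ₂.1,
      QuantumFRel.mpow_one hρ.1, Matrix.one_mul, Complex.cpow_zero, mul_one, trace_add, trace_smul,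
      Complex.real_smul, Complex.ofReal_sub, Complex.ofReal_one, sub_self] at h
    exact_mod_cast h
  have hw₁ : ∑ k, w k * τ k = 0 := by
    have h := hT 1
    simp only [neg_add_cancel, QuantumFRel.mpow_zero hρ₁.1, QuantumFRel.mpow_zero hρ₂.1,
      QuantumFRel.mpow_zero hρ.1, QuantumFRel.mpow_one hσ₁.1, QuantumFRel.mpow_one hσ₂.1,
      QuantumFRel.mpow_one hσ.1, Matrix.mul_one, Complex.cpow_one, trace_add, trace_smul,
      Complex.real_smul, Complex.ofReal_sub, Complex.ofReal_one, sub_self] at h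
    exact_mod_cast h
  constructor
  · intro heq t
    have hν := QuantumFRel.fiber_sum_eq_zero_of_diffusedOn (w := w) (τ := τ) hdiff
      (fun u v hI' => hτ u v (hI' ▸ hs₁) (hI' ▸ hs₂)) hw₀ hw₁
      (fun g hg => by
        rw [hS]
        exact sub_nonneg.2
          (QuantumFRel.fRelEntropy_jointly_convex hg hρ₁ hρ₂ hσ₁ hσ₂ hs₁ hs₂ hl0 hl1))
      (by rw [hS, heq, sub_self])
    have h := hT (Complex.I * t)
    rw [← QuantumFRel.sum_image_fiberwise w τ fun x => (x : ℂ) ^ (Complex.I * t)] at h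
    simp only [hν, Complex.ofReal_zero, zero_mul, Finset.sum_const_zero] at h
    exact (sub_eq_zero.1 h.symm).symm
  · intro htr
    have hν := QuantumFRel.fiber_sum_eq_zero_of_moments (w := w) (τ := τ) fun m => by
      have h := hT m
      -- This complex t makes the exponent ıt equal to m, so the trace identity becomes the
      -- vanishing of the m-th moment.
      have htm := htr (-Complex.I * m)
      rw [show Complex.I * (-Complex.I * m) = m by
        rw [← mul_assoc, mul_neg, Complex.I_mul_I, neg_neg, one_mul]] at htm
      rw [htm, sub_self] at h
      simp only [Complex.cpow_natCast] at h
      exact_mod_cast h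
    have h := hS f
    rw [← QuantumFRel.sum_image_fiberwise_real w τ f] at h
    simp only [hν, zero_mul, Finset.sum_const_zero] at h
    exact (sub_eq_zero.1 h.symm).symm
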